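/- Let $(\Omega,\mathcal P)$ be a probability space and let $0<A<B<1$. Let $(a_n,b_n)_{n\ge 1}$ be i.i.d. random pairs with values in $\{(x,y)\in[0,1]^2: A\le \min(x,y),\ x+y\le B\}$, and let $(p_n)_{n\ge1}$ be i.i.d. random variables with values in $[0,1]$, the sequence $(p_n)$ being independent of the sequence $((a_n,b_n))$, such that $\mathbb E(p_n^{-t})<\infty$ and $\mathbb E((1-p_n)^{-t})<\infty$ for some $t>0$ (with $0^{-t}=\infty$). For each $\omega$, start from the interval $[0,1]$ (step $0$); each interval $I$ of step $n-1$ has two children of step $n$: the left child is the closed subinterval of $I$ with the same left endpoint and length $a_n(\omega)|I|$, the right child is the closed subinterval of $I$ with the same right endpoint and length $b_n(\omega)|I|$. Let $\mu_\omega$ be the Borel probability measure on $[0,1]$ such that, for every interval $I$ of step $n-1$ ($n\ge 1$), the left child of $I$ has mass $p_n(\omega)\mu_\omega(I)$ and the right child has mass $(1-p_n(\omega))\mu_\omega(I)$. For $\theta\ge0$ set $$G(\theta)=\frac{\mathbb E(Y(\theta))}{\mathbb E(Z(\theta))},\qquad (Y(\theta),Z(\theta))=\begin{cases}(\log p_1,\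 \log a_1)&\text{if } p_1\le \dfrac{a_1^\theta}{a_1^\theta+b_1^\theta},\\[2mm] (\log(1-p_1),\ \log b_1)&\text{otherwise.}\end{cases}$$ A dimension function is a map $\Phi:(0,1)\to[0,\infty)$ such that $t^{1+\Phi(t)}$ decreases (in the weak sense) to $0$ as $t$ decreases to $0$. It is large if, for all $t$ close to $0$, $\Phi(t)=H(t)\,\dfrac{\log|\log t|}{|\log t|}$ with $H(t)\to\infty$ as $t\to0^+$. The upper $\Phi$-dimension $\overline{\dim}_\Phi\mu\in[-\infty,\infty]$ of a Borel probability measure $\mu$ on $\mathbb R$ is the infimum of all $d\in\mathbb R$ for which there are $C_1\in(0,1)$ and $C_2>0$ such that $$\frac{\mu(B(x,R))}{\mu(B(x,r))}\le C_2\left(\frac Rr\right)^d\qquad\text{for all } 0<r<R^{1+\Phi(R)}\le R\le C_1 \text{ and all } x\in\operatorname{supp}\mu,$$ where $B(x,s)$ is the open ball of radius $s$ centred at $x$. Suppose that $\alpha\ge0$ satisfies $G(\alpha)=\alpha$ and $G(\psi)<\psi$ for all $\psi>\alpha$. Then there is a measurable set $\Gamma\subseteq\Omega$ with $\mathcal P(\Gamma)=1$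 such that $\overline{\dim}_\Phi\mu_\omega=\alpha$ for every large dimension function $\Phi$ and every $\omega\in\Gamma$. -/

import Mathlib

open MeasureTheory ProbabilityTheory Filter Topology Set

noncomputable section

namespace RandomMoran

/-! ### Dimension functions and the upper `Φ`-dimension of a measure -/

/-- A dimension function: a map `Φ : (0,1) → [0,∞)` such that `t ^ (1 + Φ t)` decreases to `0`
as `t` decreases to `0`. Only the values of `Φ` on `(0,1)` matter. -/
structure IsDimensionFunction (Φ : ℝ → ℝ) : Prop where
  nonneg : ∀ t ∈ Ioo (0 : ℝ) 1, 0 ≤ Φ t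
  monotoneOn : MonotoneOn (fun t : ℝ => t ^ (1 + Φ t)) (Ioo (0 : ℝ) 1)
  tendsto_zero : Tendsto (fun t : ℝ => t ^ (1 + Φ t)) (𝓝[>] 0) (𝓝 0)

/-- `Φ` is large: `Φ t = H t * log |log t| / |log t|` near `0`, where `H t → ∞` as `t → 0⁺`. -/
def IsLarge (Φ : ℝ → ℝ) : Prop :=
  ∃ H : ℝ → ℝ, Tendsto H (𝓝[>] 0) atTop ∧
    ∀ᶠ t in 𝓝[>] (0 : ℝ), Φ t = H t * (Real.log |Real.log t| / |Real.log t|)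

/-- The set of exponents `d` admissible in the definition of the upper `Φ`-dimension. The bound
`C₁ < 1` only says that `Φ` is evaluated inside its domain `(0,1)`. -/
def upperExponents {X : Type*} [PseudoMetricSpace X] [MeasurableSpace X]
    (Φ : ℝ → ℝ) (μ : Measure X) : Set ℝ :=
  {d : ℝ | ∃ C₁ C₂ : ℝ, 0 < C₁ ∧ C₁ < 1 ∧ 0 < C₂ ∧
    ∀ r R : ℝ, 0 < r → r < R ^ (1 + Φ R) → R ^ (1 + Φ R) ≤ R → 0 < R → R ≤ C₁ →
      ∀ x ∈ μ.support,
        μ (Metric.ball x R) / μ (Metric.ball x r) ≤ ENNReal.ofReal (C₂ * (R / r) ^ d)}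

/-- The upper `Φ`-dimension of `μ`, the infimum of the admissible exponents, taken in `[-∞, ∞]`
(so that it is `∞` when there is no admissible exponent). -/
def upperPhiDim {X : Type*} [PseudoMetricSpace X] [MeasurableSpace X]
    (Φ : ℝ → ℝ) (μ : Measure X) : EReal :=
  sInf ((fun d : ℝ => (d : EReal)) '' upperExponents Φ μ)

/-! ### Moran intervals and the Moran measure for given sequences of ratios and probabilities

Levels are counted from `0`: the children of an interval of step `n` are formed with `a n`, `b n`
and `p n`. A branch is a sequence `v : ℕ → Bool`; at step `n` it goes to the left child if
`v n = false` and to the right child if `v n = true`. -/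

/-- Length of the Moran interval of step `n` along the branch `v`. -/
def moranLength (a b : ℕ → ℝ) (v : ℕ → Bool) : ℕ → ℝ
  | 0 => 1
  | n + 1 => (if v n then b n else a n) * moranLength a b v n

/-- Left endpoint of the Moran interval of step `n` along the branch `v`: a left child keeps the
left endpoint of its parent, a right child keeps the right endpoint of its parent. -/
def moranLeft (a b : ℕ → ℝ) (v : ℕ → Bool) : ℕ → ℝ
  | 0 => 0
  | n + 1 => moranLeft a b v n + (if v n then (1 - b n) * moranLength a b v n else 0)

/-- The Moran interval of step `n` along the branch `v`; it depends only on `v 0, …, v (n - 1)`. -/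
def moranInterval (a b : ℕ → ℝ) (v : ℕ → Bool) (n : ℕ) : Set ℝ :=
  Icc (moranLeft a b v n) (moranLeft a b v n + moranLength a b v n)

/-- The point `⋂ n, moranInterval a b v n`, as the supremum of the left endpoints. -/
def moranPoint (a b : ℕ → ℝ) (v : ℕ → Bool) : ℝ := ⨆ n, moranLeft a b v n

/-- The Moran measure: the image, under `v ↦ moranPoint a b v`, of the product measure on branches
that goes left at level `n` with probability `p n` and right with probability `1 - p n`. By
`moranMeasure_Icc`, `moranMeasure_left` and `moranMeasure_right` below it has mass one on `[0,1]`
and gives the left and the right child of an interval `I` of step `n` the mass `p n * μ I` and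
`(1 - p n) * μ I`; this determines it. -/
def moranMeasure (a b : ℕ → ℝ) (p : ℕ → unitInterval) : Measure ℝ :=
  (Measure.infinitePi fun n => bernoulliMeasure false true (p n)).map (moranPoint a b)

lemma measurable_moranLength (a b : ℕ → ℝ) (n : ℕ) :
    Measurable fun v : ℕ → Bool => moranLength a b v n := by
  induction n with
  | zero => exact measurable_const
  | succ n ih =>
    have h : Measurable fun v : ℕ → Bool => if v n then b n else a n :=
      (measurable_of_finite fun c : Bool => if c then b n else a n).comp (measurable_pi_apply n)
    exact h.mul ih

lemma measurable_moranLeft (a b : ℕ → ℝ) (n : ℕ) :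
    Measurable fun v : ℕ → Bool => moranLeft a b v n := by
  induction n with
  | zero => exact measurable_const
  | succ n ih =>
    have h : Measurable fun v : ℕ → Bool => if v n then (1 - b n) else 0 :=
      (measurable_of_finite fun c : Bool => if c then (1 - b n) else 0).comp
        (measurable_pi_apply n)
    have h2 : (fun v : ℕ → Bool => moranLeft a b v (n + 1)) =
        fun v => moranLeft a b v n + (if v n then (1 - b n) else 0) * moranLength a b v n := by
      funext v
      simp [moranLeft]
    rw [h2]
    exact ih.add (h.mul (measurable_moranLength a b n))

lemma measurable_moranPoint (a b : ℕ → ℝ) : Measurable (moranPoint a b) :=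
  Measurable.iSup fun n => measurable_moranLeft a b n

section Rule

variable {a b : ℕ → ℝ}

lemma moranLength_pos (ha : ∀ n, 0 < a n) (hb : ∀ n, 0 < b n) (v : ℕ → Bool) (n : ℕ) :
    0 < moranLength a b v n := by
  induction n with
  | zero => simp [moranLength]
  | succ n ih =>
    have h : 0 < (if v n then b n else a n) := by
      split_ifs
      · exact hb n
      · exact ha n
    exact mul_pos h ih

lemma moranInterval_succ_subset (ha : ∀ n, 0 < a n) (hb : ∀ n, 0 < b n)
    (hab : ∀ n, a n + b n < 1) (v : ℕ → Bool) (n : ℕ) :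
    moranInterval a b v (n + 1) ⊆ moranInterval a b v n := by
  have hl := moranLength_pos ha hb v n
  have h1 := ha n
  have h2 := hb n
  have h3 := hab n
  apply Icc_subset_Icc
  · simp only [moranLeft]
    split_ifs <;> nlinarith
  · simp only [moranLeft, moranLength]
    split_ifs <;> nlinarith

lemma moranInterval_antitone (ha : ∀ n, 0 < a n) (hb : ∀ n, 0 < b n)
    (hab : ∀ n, a n + b n < 1) (v : ℕ → Bool) : Antitone (moranInterval a b v) :=
  antitone_nat_of_succ_le (moranInterval_succ_subset ha hb hab v)

lemma moranPoint_mem (ha : ∀ n, 0 < a n) (hb : ∀ n, 0 < b n)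
    (hab : ∀ n, a n + b n < 1) (v : ℕ → Bool) (n : ℕ) :
    moranPoint a b v ∈ moranInterval a b v n := by
  have hanti := moranInterval_antitone ha hb hab v
  have hmem : ∀ m, moranLeft a b v m ∈ moranInterval a b v m := fun m =>
    left_mem_Icc.2 (by linarith [moranLength_pos ha hb v m])
  have hup : ∀ m, moranLeft a b v m ≤ moranLeft a b v n + moranLength a b v n := by
    intro m
    have hle : moranLeft a b v m ≤ moranLeft a b v (max m n) :=
      (hanti (le_max_left m n) (hmem _)).1
    exact hle.trans (hanti (le_max_right m n) (hmem _)).2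
  exact ⟨le_ciSup (f := moranLeft a b v) ⟨_, by rintro _ ⟨m, rfl⟩; exact hup m⟩ n, ciSup_le hup⟩

lemma moranLength_congr {v w : ℕ → Bool} {n : ℕ} (h : ∀ i < n, w i = v i) :
    moranLength a b w n = moranLength a b v n := by
  induction n with
  | zero => rfl
  | succ n ih =>
    simp only [moranLength, h n (Nat.lt_succ_self n),
      ih fun i hi => h i (hi.trans (Nat.lt_succ_self n))]

lemma moranLeft_congr {v w : ℕ → Bool} {n : ℕ} (h : ∀ i < n, w i = v i) :
    moranLeft a b w n = moranLeft a b v n := by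
  induction n with
  | zero => rfl
  | succ n ih =>
    have h' : ∀ i < n, w i = v i := fun i hi => h i (hi.trans (Nat.lt_succ_self n))
    simp only [moranLeft, h n (Nat.lt_succ_self n), ih h', moranLength_congr h']

lemma moranPoint_mem_iff (ha : ∀ n, 0 < a n) (hb : ∀ n, 0 < b n)
    (hab : ∀ n, a n + b n < 1) (v w : ℕ → Bool) (n : ℕ) :
    moranPoint a b w ∈ moranInterval a b v n ↔ ∀ i < n, w i = v i := by
  constructor
  · intro h
    induction n with
    | zero => intro i hi; exact absurd hi (Nat.not_lt_zero i)
    | succ n ih =>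
      have hv := ih (moranInterval_succ_subset ha hb hab v n h)
      intro i hi
      rcases Nat.lt_succ_iff_lt_or_eq.1 hi with hi | rfl
      · exact hv i hi
      · have hw := moranPoint_mem ha hb hab w (i + 1)
        have hl := moranLength_pos ha hb v i
        have h3 := hab i
        simp only [moranInterval, moranLeft, moranLength, mem_Icc, moranLeft_congr hv,
          moranLength_congr hv] at h hw
        cases h1 : v i <;> cases h2 : w i <;> simp only [h1, h2] at h hw ⊢
        all_goals
          exfalso
          simp at h hw
          nlinarith [h.1, h.2, hw.1, hw.2]
  · intro h
    have hw := moranPoint_mem ha hb hab w n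
    rwa [moranInterval, moranLeft_congr h, moranLength_congr h] at hw

lemma moranMeasure_moranInterval (ha : ∀ n, 0 < a n) (hb : ∀ n, 0 < b n)
    (hab : ∀ n, a n + b n < 1) (p : ℕ → unitInterval) (v : ℕ → Bool) (n : ℕ) :
    moranMeasure a b p (moranInterval a b v n) =
      ∏ i ∈ Finset.range n, bernoulliMeasure false true (p i) {v i} := by
  have hset : moranPoint a b ⁻¹' moranInterval a b v n =
      Set.pi (Finset.range n : Finset ℕ) fun i => {v i} := by
    ext w
    simp [moranPoint_mem_iff ha hb hab]
  rw [moranMeasure, Measure.map_apply (measurable_moranPoint a b)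
    (by exact measurableSet_Icc : MeasurableSet (moranInterval a b v n)), hset,
    Measure.infinitePi_pi _ fun i _ => measurableSet_singleton _]

/-- The Moran measure gives mass one to `[0,1]`. -/
theorem moranMeasure_Icc (ha : ∀ n, 0 < a n) (hb : ∀ n, 0 < b n)
    (hab : ∀ n, a n + b n < 1) (p : ℕ → unitInterval) :
    moranMeasure a b p (Icc 0 1) = 1 := by
  have h := moranMeasure_moranInterval ha hb hab p (fun _ => false) 0
  simpa [moranInterval, moranLeft, moranLength] using h

/-- The Moran measure has total mass one. -/
instance isProbabilityMeasure_moranMeasure (a b : ℕ → ℝ) (p : ℕ → unitInterval) : IsProbabilityMeasure (moranMeasure a b p) :=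
  Measure.isProbabilityMeasure_map (measurable_moranPoint a b).aemeasurable

/-- The left child of an interval of step `n` gets the fraction `p n` of its mass. -/
theorem moranMeasure_left (ha : ∀ n, 0 < a n) (hb : ∀ n, 0 < b n)
    (hab : ∀ n, a n + b n < 1) (p : ℕ → unitInterval) (v : ℕ → Bool) (n : ℕ)
    (hv : v n = false) :
    moranMeasure a b p (moranInterval a b v (n + 1)) =
      ENNReal.ofReal (p n) * moranMeasure a b p (moranInterval a b v n) := by
  rw [moranMeasure_moranInterval ha hb hab, moranMeasure_moranInterval ha hb hab,
    Finset.prod_range_succ, mul_comm, hv,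
    bernoulliMeasure_apply_of_mem_of_notMem (p n) (measurableSet_singleton _) rfl (by simp)]
  congr 1
  rw [ENNReal.ofReal]
  congr 1
  exact (Real.toNNReal_of_nonneg _).symm

/-- The right child of an interval of step `n` gets the fraction `1 - p n` of its mass. -/
theorem moranMeasure_right (ha : ∀ n, 0 < a n) (hb : ∀ n, 0 < b n)
    (hab : ∀ n, a n + b n < 1) (p : ℕ → unitInterval) (v : ℕ → Bool) (n : ℕ)
    (hv : v n = true) :
    moranMeasure a b p (moranInterval a b v (n + 1)) =
      ENNReal.ofReal (1 - p n) * moranMeasure a b p (moranInterval a b v n) := by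
  rw [moranMeasure_moranInterval ha hb hab, moranMeasure_moranInterval ha hb hab,
    Finset.prod_range_succ, mul_comm, hv,
    bernoulliMeasure_apply_of_notMem_of_mem (p n) (measurableSet_singleton _) (by simp) rfl]
  congr 1
  rw [← unitInterval.coe_symm_eq, ENNReal.ofReal]
  congr 1
  exact (Real.toNNReal_of_nonneg _).symm

end Rule

/-! ### The random model -/

/-- The standing assumptions on the random ratios `a n`, `b n` and probabilities `p n`
on the probability space `(Ω, P)`:
* `0 < A < B < 1`, and `(a n, b n)` takes values in `{(x, y) : A ≤ min x y, x + y ≤ B}` (so that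
  `𝔼 (a n ^ (-t))` and `𝔼 (b n ^ (-t))` are automatically finite);
* the pairs `(a n, b n)` are independent and identically distributed;
* the `p n` are independent and identically distributed in `[0,1]`, and the sequence `p` is
  independent of the sequence `(a, b)`;
* `𝔼 (p n ^ (-t)) < ∞` and `𝔼 ((1 - p n) ^ (-t)) < ∞` for some `t > 0` (where `0 ^ (-t) = ∞`). -/
structure IsRandomMoranModel {Ω : Type*} [MeasurableSpace Ω] (P : Measure Ω) (A B : ℝ)
    (a b : ℕ → Ω → ℝ) (p : ℕ → Ω → unitInterval) : Prop where
  A_pos : 0 < A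
  A_lt_B : A < B
  B_lt_one : B < 1
  measurable_a : ∀ n, Measurable (a n)
  measurable_b : ∀ n, Measurable (b n)
  measurable_p : ∀ n, Measurable (p n)
  le_min : ∀ n ω, A ≤ min (a n ω) (b n ω)
  add_le : ∀ n ω, a n ω + b n ω ≤ B
  indep_ab : iIndepFun (fun n ω => (a n ω, b n ω)) P
  ident_ab : ∀ n, IdentDistrib (fun ω => (a n ω, b n ω)) (fun ω => (a 0 ω, b 0 ω)) P P
  indep_p : iIndepFun p P
  ident_p : ∀ n, IdentDistrib (p n) (p 0) P P
  indep_ab_p : IndepFun (fun ω n => (a n ω, b n ω)) (fun ω n => p n ω) P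
  moment_p : ∃ t : ℝ, 0 < t ∧ ∀ n,
    ∫⁻ ω, ENNReal.ofReal (p n ω : ℝ) ^ (-t) ∂P < ⊤ ∧
    ∫⁻ ω, ENNReal.ofReal (1 - (p n ω : ℝ)) ^ (-t) ∂P < ⊤

/-- The random measure `μ_ω`. -/
def randomMoranMeasure {Ω : Type*} (a b : ℕ → Ω → ℝ) (p : ℕ → Ω → unitInterval) (ω : Ω) :
    Measure ℝ :=
  moranMeasure (fun n => a n ω) (fun n => b n ω) (fun n => p n ω)

/-- `Y(θ)` for the values `x`, `y`, `q` of `a n`, `b n`, `p n`. -/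
def Yval (θ x y q : ℝ) : ℝ :=
  if q ≤ x ^ θ / (x ^ θ + y ^ θ) then Real.log q else Real.log (1 - q)

/-- `Z(θ)` for the values `x`, `y`, `q` of `a n`, `b n`, `p n`. -/
def Zval (θ x y q : ℝ) : ℝ :=
  if q ≤ x ^ θ / (x ^ θ + y ^ θ) then Real.log x else Real.log y

/-- `G(θ) = 𝔼(Y₁(θ)) / 𝔼(Z₁(θ))`; the first level has index `0` here. -/
def G {Ω : Type*} [MeasurableSpace Ω] (P : Measure Ω) (a b : ℕ → Ω → ℝ)
    (p : ℕ → Ω → unitInterval) (θ : ℝ) : ℝ :=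
  (∫ ω, Yval θ (a 0 ω) (b 0 ω) (p 0 ω) ∂P) / ∫ ω, Zval θ (a 0 ω) (b 0 ω) (p 0 ω) ∂P

end RandomMoran

end

/-!
Along a branch of the construction let `L n` and `M n` be the length and the mass of the interval of
step `n`. Since the children of an interval leave a definite gap, the mass of a ball of radius `R`
centred in the support lies between the masses of two intervals around its centre whose lengths are
comparable to `R`. The upper `Φ`-dimension is thus governed by comparing `M N / M (N + n)` with
powers of `L N / L (N + n)`. The difference `θ * log L - log M` is a sum of one term per step;
choosing at each step the child with the larger term yields i.i.d. random variables, the excesses,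
with mean `(θ - G θ) * 𝔼 (Z θ)`, and `𝔼 (Z θ) < 0`.

For `θ = α` the mean vanishes. The law of large numbers along the branch that realizes all the
excesses then shows that no exponent below `α` is admissible.

For `θ > α` the mean is negative, because raising `θ` lowers every term by a definite amount. By
Chernoff's bound the sum over a window of `n` steps is positive with exponentially small
probability, so by Borel–Cantelli, eventually in `n`, none of the windows `[N, N + n)` with
`N ≤ exp (c * n)` has a positive sum. Largeness of `Φ` is what makes this enough: at scale `R` the
window starts at `N = O(log (1 / R))` and its length is large compared with `log (log (1 / R))`.
-/

noncomputable section

namespace RandomMoran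

section UpperPhiDimension

variable {X : Type*} [PseudoMetricSpace X] [MeasurableSpace X] {Φ : ℝ → ℝ} {μ : Measure X}

lemma upperPhiDim_eq_coe_of_isGLB {α : ℝ} (h : IsGLB (upperExponents Φ μ) α) :
    upperPhiDim Φ μ = (α : EReal) := by
  have hmono : MonotoneOn (fun d : ℝ => (d : EReal)) (upperExponents Φ μ) :=
    fun _ _ _ _ hde => EReal.coe_le_coe_iff.2 hde
  have hcont : Tendsto (fun d : ℝ => (d : EReal)) (𝓝[upperExponents Φ μ] α) (𝓝 (α : EReal)) :=
    continuous_coe_real_ereal.continuousWithinAt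
  exact (h.isGLB_of_tendsto hmono h.nonempty hcont).sInf_eq

lemma exists_mul_rpow_le_measureReal_ball [IsFiniteMeasure μ] {x : X} {d : ℝ}
    (hx : x ∈ μ.support) (hΦ : ∃ᶠ R in 𝓝[>] (0 : ℝ), 0 ≤ Φ R) (hd : d ∈ upperExponents Φ μ) :
    ∃ C : ℝ, 0 < C ∧ ∀ᶠ r in 𝓝[>] (0 : ℝ), C * r ^ d ≤ μ.real (Metric.ball x r) := by
  obtain ⟨C₁, C₂, hC₁, hC₁', hC₂, hratio⟩ := hd
  obtain ⟨R, hΦR, hR, hRC⟩ := (hΦ.and_eventually (Ioc_mem_nhdsGT hC₁)).exists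
  have hball : ∀ r : ℝ, 0 < r → 0 < μ.real (Metric.ball x r) := fun r hr =>
    ENNReal.toReal_pos (Metric.nhds_basis_ball.mem_measureSupport.1 hx r hr).ne'
      (measure_ne_top _ _)
  have hRΦ : R ^ (1 + Φ R) ≤ R :=
    (Real.rpow_le_rpow_of_exponent_ge hR (hRC.trans hC₁'.le) (by linarith)).trans_eq
      (Real.rpow_one R)
  refine ⟨μ.real (Metric.ball x R) / (C₂ * R ^ d),
    div_pos (hball R hR) (mul_pos hC₂ (Real.rpow_pos_of_pos hR d)), ?_⟩
  filter_upwards [Ioo_mem_nhdsGT (Real.rpow_pos_of_pos hR (1 + Φ R))] with r ⟨hr, hrR⟩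
  have hle : μ.real (Metric.ball x R) / μ.real (Metric.ball x r) ≤ C₂ * (R / r) ^ d := by
    rw [Measure.real, Measure.real, ← ENNReal.toReal_div]
    exact ENNReal.toReal_le_of_le_ofReal (by positivity) (hratio r R hr hrR hRΦ hR hRC x hx)
  rw [div_le_iff₀ (hball r hr), Real.div_rpow hR.le hr.le] at hle
  calc μ.real (Metric.ball x R) / (C₂ * R ^ d) * r ^ d
      ≤ C₂ * (R ^ d / r ^ d) * μ.real (Metric.ball x r) / (C₂ * R ^ d) * r ^ d := by gcongr
    _ = μ.real (Metric.ball x r) := by field_simp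

end UpperPhiDimension

lemma tendsto_neg_log_nhdsGT_zero : Tendsto (fun R => -Real.log R) (𝓝[>] (0 : ℝ)) atTop :=
  tendsto_neg_atBot_atTop.comp Real.tendsto_log_nhdsGT_zero

lemma eventually_natCast_le_sq_log {A B : ℝ} (hA : 0 < A) (hB : 0 < B) (hB1 : B < 1) :
    ∀ᶠ R in 𝓝[>] (0 : ℝ), ∀ N : ℕ, A * R ≤ B ^ N → (N : ℝ) ≤ (-Real.log R) ^ 2 := by
  have hlogB : 0 < -Real.log B := neg_pos.2 (Real.log_neg hB hB1)
  filter_upwards [self_mem_nhdsWithin, tendsto_neg_log_nhdsGT_zero.eventually_ge_atTop 1,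
    tendsto_neg_log_nhdsGT_zero.eventually_ge_atTop ((1 + |Real.log A|) / -Real.log B)]
    with R (hR : 0 < R) hR1 hRB N hN
  have hlog := Real.log_le_log (mul_pos hA hR) hN
  rw [Real.log_mul hA.ne' hR.ne', Real.log_pow] at hlog
  rw [div_le_iff₀ hlogB] at hRB
  refine le_of_mul_le_mul_right ?_ hlogB
  calc (N : ℝ) * -Real.log B ≤ |Real.log A| * 1 + -Real.log R := by
        linarith [neg_abs_le (Real.log A)]
    _ ≤ |Real.log A| * -Real.log R + -Real.log R := by gcongr
    _ = (1 + |Real.log A|) * -Real.log R := by ring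
    _ ≤ -Real.log R * -Real.log B * -Real.log R := by gcongr
    _ = (-Real.log R) ^ 2 * -Real.log B := by ring

namespace IsLarge

variable {Φ : ℝ → ℝ}

lemma eventually_mul_log_log_le (hΦ : IsLarge Φ) (K : ℝ) :
    ∀ᶠ R in 𝓝[>] (0 : ℝ), K * Real.log (-Real.log R) ≤ Φ R * -Real.log R := by
  obtain ⟨H, hH, hΦH⟩ := hΦ
  filter_upwards [hH.eventually_ge_atTop K, hΦH,
    tendsto_neg_log_nhdsGT_zero.eventually_ge_atTop 1] with R hK hΦR hR
  rw [hΦR, abs_of_neg (by linarith), mul_assoc, div_mul_cancel₀ _ (by linarith)]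
  exact mul_le_mul_of_nonneg_right hK (Real.log_nonneg hR)

lemma eventually_nonneg (hΦ : IsLarge Φ) : ∀ᶠ R in 𝓝[>] (0 : ℝ), 0 ≤ Φ R := by
  filter_upwards [hΦ.eventually_mul_log_log_le 0,
    tendsto_neg_log_nhdsGT_zero.eventually_gt_atTop 0] with R hΦR hR
  exact nonneg_of_mul_nonneg_left (by simpa only [zero_mul] using hΦR) hR

lemma eventually_mul_log_log_le_of_pow_le_rpow (hΦ : IsLarge Φ) {A : ℝ} (hA : 0 < A)
    (hA1 : A < 1) (K : ℝ) :
    ∀ᶠ R in 𝓝[>] (0 : ℝ), ∀ n : ℕ, A ^ n ≤ R ^ Φ R → K * Real.log (-Real.log R) ≤ n := by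
  filter_upwards [hΦ.eventually_mul_log_log_le (K * -Real.log A), self_mem_nhdsWithin]
    with R hΦR hR n hn
  have hlog := Real.log_le_log (pow_pos hA n) hn
  rw [Real.log_pow, Real.log_rpow hR] at hlog
  refine le_of_mul_le_mul_right ?_ (neg_pos.2 (Real.log_neg hA hA1))
  linarith

lemma eventually_le_and_le_exp (hΦ : IsLarge Φ) {A B c : ℝ} (hA : 0 < A) (hA1 : A < 1)
    (hB : 0 < B) (hB1 : B < 1) (hc : 0 < c) (n₀ : ℕ) :
    ∀ᶠ R in 𝓝[>] (0 : ℝ), ∀ N n : ℕ, A * R ≤ B ^ N → A ^ (n + 1) ≤ R ^ Φ R →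
      n₀ ≤ n ∧ (N : ℝ) ≤ Real.exp (c * n) := by
  filter_upwards [eventually_natCast_le_sq_log hA hB hB1,
    hΦ.eventually_mul_log_log_le_of_pow_le_rpow hA hA1 (2 / c + (n₀ + 1)),
    tendsto_neg_log_nhdsGT_zero.eventually_ge_atTop (Real.exp 1)] with R hN hn hR N n hRN hRn
  have hlogR : 0 < -Real.log R := (Real.exp_pos 1).trans_le hR
  have hloglog : 1 ≤ Real.log (-Real.log R) := (Real.le_log_iff_exp_le hlogR).2 hR
  have hle : 2 / c * Real.log (-Real.log R) + (n₀ + 1) ≤ n + 1 := by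
    calc 2 / c * Real.log (-Real.log R) + (n₀ + 1)
        ≤ 2 / c * Real.log (-Real.log R) + (n₀ + 1) * Real.log (-Real.log R) := by
          gcongr
          exact le_mul_of_one_le_right (by positivity) hloglog
      _ = (2 / c + (n₀ + 1)) * Real.log (-Real.log R) := by ring
      _ ≤ n + 1 := by exact_mod_cast hn (n + 1) hRn
  have hpos : 0 ≤ 2 / c * Real.log (-Real.log R) := by positivity
  refine ⟨by exact_mod_cast (by linarith : (n₀ : ℝ) ≤ n), ?_⟩
  calc (N : ℝ) ≤ (-Real.log R) ^ 2 := hN N hRN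
    _ = Real.exp (2 * Real.log (-Real.log R)) := by
      rw [mul_comm, Real.exp_mul, Real.exp_log hlogR, Real.rpow_two]
    _ = Real.exp (c * (2 / c * Real.log (-Real.log R))) := by
      rw [← mul_assoc, mul_div_cancel₀ _ hc.ne']
    _ ≤ Real.exp (c * n) := by
      gcongr
      linarith [(Nat.cast_nonneg n₀ : (0 : ℝ) ≤ n₀)]

end IsLarge

section Excess

/-- The proportion of mass given to the child `c` (left for `false`, right for `true`) when the left
child receives the proportion `q`. -/
def branchWeight (q : ℝ) (c : Bool) : ℝ := if c then 1 - q else q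

/-- The contraction ratio of the child `c` when the left and right children have ratios `x`, `y`. -/
def branchRatio (x y : ℝ) (c : Bool) : ℝ := if c then y else x

/-- The logarithm of `ratio ^ θ / weight` for the child `c`. It is positive when the mass of the
child decays faster than the power `θ` of its length. -/
def branchExcess (θ x y q : ℝ) (c : Bool) : ℝ :=
  θ * Real.log (branchRatio x y c) - Real.log (branchWeight q c)

/-- The larger of the excesses of the two children. -/
def excess (θ x y q : ℝ) : ℝ := max (branchExcess θ x y q false) (branchExcess θ x y q true)

variable {θ x y q : ℝ}

lemma branchWeight_pos (hq : q ∈ Ioo (0 : ℝ) 1) : ∀ c, 0 < branchWeight q c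
  | false => hq.1
  | true => sub_pos.2 hq.2

lemma branchExcess_le_excess : ∀ c, branchExcess θ x y q c ≤ excess θ x y q
  | false => le_max_left _ _
  | true => le_max_right _ _

lemma exists_branchExcess_eq_excess (θ x y q : ℝ) :
    ∃ c, branchExcess θ x y q c = excess θ x y q :=
  (max_choice (branchExcess θ x y q false) (branchExcess θ x y q true)).elim
    (fun h => ⟨false, h.symm⟩) fun h => ⟨true, h.symm⟩

lemma le_rpow_div_iff_branchExcess_le (hx : 0 < x) (hy : 0 < y) (hq : q ∈ Ioo (0 : ℝ) 1) :
    q ≤ x ^ θ / (x ^ θ + y ^ θ) ↔ branchExcess θ x y q true ≤ branchExcess θ x y q false := by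
  have hq' : 0 < 1 - q := sub_pos.2 hq.2
  have hxθ := Real.rpow_pos_of_pos hx θ
  have hyθ := Real.rpow_pos_of_pos hy θ
  calc q ≤ x ^ θ / (x ^ θ + y ^ θ) ↔ q * y ^ θ ≤ (1 - q) * x ^ θ := by
        rw [le_div_iff₀ (add_pos hxθ hyθ)]
        constructor <;> intro h <;> linarith
    _ ↔ Real.log (q * y ^ θ) ≤ Real.log ((1 - q) * x ^ θ) :=
        (Real.log_le_log_iff (mul_pos hq.1 hyθ) (mul_pos hq' hxθ)).symm
    _ ↔ θ * Real.log y - Real.log (1 - q) ≤ θ * Real.log x - Real.log q := by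
        rw [Real.log_mul hq.1.ne' hyθ.ne', Real.log_mul hq'.ne' hxθ.ne', Real.log_rpow hx,
          Real.log_rpow hy]
        constructor <;> intro h <;> linarith

lemma excess_eq (hx : 0 < x) (hy : 0 < y) (hq : q ∈ Ioo (0 : ℝ) 1) :
    excess θ x y q = θ * Zval θ x y q - Yval θ x y q := by
  have hiff := le_rpow_div_iff_branchExcess_le (θ := θ) hx hy hq
  unfold Zval Yval
  split_ifs with h
  · exact max_eq_left (hiff.1 h)
  · exact max_eq_right (le_of_not_ge (mt hiff.2 h))

lemma Yval_nonpos (hq : q ∈ Icc (0 : ℝ) 1) : Yval θ x y q ≤ 0 := by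
  unfold Yval
  split_ifs
  · exact Real.log_nonpos hq.1 hq.2
  · exact Real.log_nonpos (sub_nonneg.2 hq.2) (sub_le_self 1 hq.1)

lemma excess_add_le {δ L : ℝ} (hδ : 0 ≤ δ) (hx : Real.log x ≤ L) (hy : Real.log y ≤ L) :
    excess (θ + δ) x y q ≤ excess θ x y q + δ * L := by
  have hbranch : ∀ c, branchExcess (θ + δ) x y q c ≤ excess θ x y q + δ * L := fun c => by
    have hratio : Real.log (branchRatio x y c) ≤ L := by cases c <;> assumption
    calc branchExcess (θ + δ) x y q c
        = branchExcess θ x y q c + δ * Real.log (branchRatio x y c) := by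
          unfold branchExcess
          ring
      _ ≤ excess θ x y q + δ * L := by
          gcongr
          exact branchExcess_le_excess c
  exact max_le (hbranch false) (hbranch true)

lemma neg_mul_le_excess {K : ℝ} (hx : |Real.log x| ≤ K) (hq : q ∈ Ioo (0 : ℝ) 1) :
    -(|θ| * K) ≤ excess θ x y q := by
  calc -(|θ| * K) ≤ -|θ * Real.log x| := by
        rw [abs_mul]
        gcongr
    _ ≤ θ * Real.log x - Real.log q := by
        linarith [neg_abs_le (θ * Real.log x), Real.log_neg hq.1 hq.2]
    _ ≤ excess θ x y q := branchExcess_le_excess false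

lemma exp_mul_branchExcess_le {K t : ℝ} (ht : 0 ≤ t) (hq : q ∈ Ioo (0 : ℝ) 1) {c : Bool}
    (hc : |Real.log (branchRatio x y c)| ≤ K) :
    Real.exp (t * branchExcess θ x y q c) ≤
      Real.exp (t * (|θ| * K)) * branchWeight q c ^ (-t) := by
  rw [Real.rpow_def_of_pos (branchWeight_pos hq c), ← Real.exp_add, Real.exp_le_exp]
  have hθ : θ * Real.log (branchRatio x y c) ≤ |θ| * K :=
    calc θ * Real.log (branchRatio x y c) ≤ |θ| * |Real.log (branchRatio x y c)| :=
          (le_abs_self _).trans_eq (abs_mul _ _)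
      _ ≤ |θ| * K := by gcongr
  calc t * branchExcess θ x y q c
      = t * (θ * Real.log (branchRatio x y c)) + Real.log (branchWeight q c) * -t := by
        unfold branchExcess
        ring
    _ ≤ t * (|θ| * K) + Real.log (branchWeight q c) * -t := by gcongr

lemma exp_mul_excess_le {K t : ℝ} (ht : 0 ≤ t) (hx : |Real.log x| ≤ K) (hy : |Real.log y| ≤ K)
    (hq : q ∈ Ioo (0 : ℝ) 1) :
    Real.exp (t * excess θ x y q) ≤
      Real.exp (t * (|θ| * K)) * (q ^ (-t) + (1 - q) ^ (-t)) := by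
  have hq₀ : 0 ≤ q ^ (-t) := Real.rpow_nonneg hq.1.le _
  have hq₁ : 0 ≤ (1 - q) ^ (-t) := Real.rpow_nonneg (sub_pos.2 hq.2).le _
  obtain ⟨c, hc⟩ := exists_branchExcess_eq_excess θ x y q
  rw [← hc]
  refine (exp_mul_branchExcess_le ht hq (by cases c <;> assumption)).trans ?_
  gcongr
  cases c
  · exact le_add_of_nonneg_right hq₁
  · exact le_add_of_nonneg_left hq₀

lemma measurable_excess (θ : ℝ) :
    Measurable fun z : (ℝ × ℝ) × unitInterval => excess θ z.1.1 z.1.2 z.2 := by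
  have hx : Measurable fun z : (ℝ × ℝ) × unitInterval => z.1.1 := measurable_fst.fst
  have hy : Measurable fun z : (ℝ × ℝ) × unitInterval => z.1.2 := measurable_fst.snd
  have hq : Measurable fun z : (ℝ × ℝ) × unitInterval => (z.2 : ℝ) := measurable_snd.subtype_val
  exact ((hx.log.const_mul θ).sub hq.log).max
    ((hy.log.const_mul θ).sub (measurable_const.sub hq).log)

end Excess

section BranchMass

/-- The mass of the Moran interval of step `n` along the branch `v`. -/
def branchMass (p : ℕ → unitInterval) (v : ℕ → Bool) (n : ℕ) : ℝ :=
  ∏ i ∈ Finset.range n, branchWeight (p i) (v i)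

lemma branchMass_succ (p : ℕ → unitInterval) (v : ℕ → Bool) (n : ℕ) :
    branchMass p v (n + 1) = branchMass p v n * branchWeight (p n) (v n) :=
  Finset.prod_range_succ _ _

lemma branchMass_pos {p : ℕ → unitInterval} (hp : ∀ n, (p n : ℝ) ∈ Ioo (0 : ℝ) 1)
    (v : ℕ → Bool) (n : ℕ) : 0 < branchMass p v n :=
  Finset.prod_pos fun i _ => branchWeight_pos (hp i) (v i)

lemma moranLength_succ (a b : ℕ → ℝ) (v : ℕ → Bool) (n : ℕ) :
    moranLength a b v (n + 1) = branchRatio (a n) (b n) (v n) * moranLength a b v n :=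
  rfl

end BranchMass

/-- The sums of `u` over the windows `[N, N + n)` are nonpositive once `n` is large and at least
logarithmically long in `N`. -/
def LongWindowSumsNonpos (u : ℕ → ℝ) : Prop :=
  ∃ c : ℝ, 0 < c ∧ ∀ᶠ n : ℕ in atTop, ∀ N : ℕ, (N : ℝ) ≤ Real.exp (c * n) →
    ∑ i ∈ Finset.range n, u (N + i) ≤ 0

/-- Uniform bounds on the ratios of a Moran construction: all of them are at least `A > 0`, and
the children of an interval leave a gap of at least the proportion `1 - B > 0`. -/
structure HasRatioBounds (A B : ℝ) (a b : ℕ → ℝ) : Prop where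
  A_pos : 0 < A
  B_lt_one : B < 1
  le_a : ∀ n, A ≤ a n
  le_b : ∀ n, A ≤ b n
  add_le : ∀ n, a n + b n ≤ B

namespace HasRatioBounds

variable {A B : ℝ} {a b : ℕ → ℝ}

lemma A_lt_B (h : HasRatioBounds A B a b) : A < B := by
  linarith [h.A_pos, h.le_a 0, h.le_b 0, h.add_le 0]

lemma B_pos (h : HasRatioBounds A B a b) : 0 < B :=
  h.A_pos.trans h.A_lt_B

lemma a_pos (h : HasRatioBounds A B a b) (n : ℕ) : 0 < a n :=
  h.A_pos.trans_le (h.le_a n)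

lemma b_pos (h : HasRatioBounds A B a b) (n : ℕ) : 0 < b n :=
  h.A_pos.trans_le (h.le_b n)

lemma add_lt_one (h : HasRatioBounds A B a b) (n : ℕ) : a n + b n < 1 :=
  (h.add_le n).trans_lt h.B_lt_one

lemma le_branchRatio (h : HasRatioBounds A B a b) (n : ℕ) :
    ∀ c, A ≤ branchRatio (a n) (b n) c
  | false => h.le_a n
  | true => h.le_b n

lemma branchRatio_pos (h : HasRatioBounds A B a b) (n : ℕ) (c : Bool) :
    0 < branchRatio (a n) (b n) c :=
  h.A_pos.trans_le (h.le_branchRatio n c)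

lemma branchRatio_le (h : HasRatioBounds A B a b) (n : ℕ) :
    ∀ c, branchRatio (a n) (b n) c ≤ B
  | false => (le_add_of_nonneg_right (h.b_pos n).le).trans (h.add_le n)
  | true => (le_add_of_nonneg_left (h.a_pos n).le).trans (h.add_le n)

lemma log_branchRatio_mem_Icc (h : HasRatioBounds A B a b) (n : ℕ) (c : Bool) :
    Real.log (branchRatio (a n) (b n) c) ∈ Icc (Real.log A) (Real.log B) :=
  ⟨Real.log_le_log h.A_pos (h.le_branchRatio n c),
    Real.log_le_log (h.branchRatio_pos n c) (h.branchRatio_le n c)⟩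

section Length

lemma length_pos (h : HasRatioBounds A B a b) (v : ℕ → Bool) (n : ℕ) : 0 < moranLength a b v n :=
  moranLength_pos h.a_pos h.b_pos v n

lemma length_succ_le (h : HasRatioBounds A B a b) (v : ℕ → Bool) (n : ℕ) :
    moranLength a b v (n + 1) ≤ B * moranLength a b v n :=
  mul_le_mul_of_nonneg_right (h.branchRatio_le n _) (h.length_pos v n).le

lemma mul_length_le_length_succ (h : HasRatioBounds A B a b) (v : ℕ → Bool) (n : ℕ) :
    A * moranLength a b v n ≤ moranLength a b v (n + 1) :=
  mul_le_mul_of_nonneg_right (h.le_branchRatio n _) (h.length_pos v n).le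

lemma length_antitone (h : HasRatioBounds A B a b) (v : ℕ → Bool) :
    Antitone (moranLength a b v) :=
  antitone_nat_of_succ_le fun n => (h.length_succ_le v n).trans <|
    mul_le_of_le_one_left (h.length_pos v n).le h.B_lt_one.le

lemma length_le_pow (h : HasRatioBounds A B a b) (v : ℕ → Bool) (n : ℕ) :
    moranLength a b v n ≤ B ^ n := by
  induction n with
  | zero => exact le_rfl
  | succ n ih =>
    rw [pow_succ']
    exact (h.length_succ_le v n).trans (mul_le_mul_of_nonneg_left ih h.B_pos.le)

lemma pow_mul_length_le (h : HasRatioBounds A B a b) (v : ℕ → Bool) (N n : ℕ) :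
    A ^ n * moranLength a b v N ≤ moranLength a b v (N + n) := by
  induction n with
  | zero => simp
  | succ n ih =>
    rw [pow_succ', mul_assoc]
    exact (mul_le_mul_of_nonneg_left ih h.A_pos.le).trans (h.mul_length_le_length_succ v (N + n))

lemma tendsto_length (h : HasRatioBounds A B a b) (v : ℕ → Bool) :
    Tendsto (moranLength a b v) atTop (𝓝 0) :=
  squeeze_zero (fun n => (h.length_pos v n).le) (h.length_le_pow v)
    (tendsto_pow_atTop_nhds_zero_of_lt_one h.B_pos.le h.B_lt_one)

lemma exists_length_lt (h : HasRatioBounds A B a b) (v : ℕ → Bool) {s : ℝ} (hs : 0 < s) :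
    ∃ n, moranLength a b v n < s :=
  ((h.tendsto_length v).eventually_lt_const hs).exists

lemma exists_first_length_lt (h : HasRatioBounds A B a b) (v : ℕ → Bool) {s : ℝ} (hs : 0 < s)
    (hs1 : s ≤ 1) :
    ∃ N, moranLength a b v N < s ∧ A * s ≤ moranLength a b v N ∧
      ∀ k < N, s ≤ moranLength a b v k := by
  obtain ⟨N, hN, hfirst⟩ : ∃ N, moranLength a b v N < s ∧ ∀ k < N, s ≤ moranLength a b v k := by
    classical
    have hex := h.exists_length_lt v hs
    exact ⟨Nat.find hex, Nat.find_spec hex, fun k hk => not_lt.1 (Nat.find_min hex hk)⟩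
  refine ⟨N, hN, ?_, hfirst⟩
  cases N with
  | zero => exact mul_le_one₀ (h.A_lt_B.trans h.B_lt_one).le hs.le hs1
  | succ N =>
    exact (mul_le_mul_of_nonneg_left (hfirst N N.lt_succ_self) h.A_pos.le).trans
      (h.mul_length_le_length_succ v N)

end Length

section Point

lemma le_moranPoint_sub (h : HasRatioBounds A B a b) {v w : ℕ → Bool} {k : ℕ}
    (hvw : ∀ i < k, w i = v i) (hv : v k = false) (hw : w k = true) :
    (1 - B) * moranLength a b v k ≤ moranPoint a b w - moranPoint a b v := by
  have hpv := (moranPoint_mem h.a_pos h.b_pos h.add_lt_one v (k + 1)).2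
  have hpw := (moranPoint_mem h.a_pos h.b_pos h.add_lt_one w (k + 1)).1
  simp only [moranLeft, moranLength, hv, hw, moranLeft_congr hvw, moranLength_congr hvw,
    Bool.false_eq_true, if_true, if_false] at hpv hpw
  linarith [mul_le_mul_of_nonneg_right (h.add_le k) (h.length_pos v k).le]

lemma le_abs_moranPoint_sub (h : HasRatioBounds A B a b) {v w : ℕ → Bool} {k : ℕ}
    (hvw : ∀ i < k, w i = v i) (hk : w k ≠ v k) :
    (1 - B) * moranLength a b v k ≤ |moranPoint a b w - moranPoint a b v| := by
  cases hv : v k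
  · have hw : w k = true := by simpa [hv] using hk
    exact (h.le_moranPoint_sub hvw hv hw).trans (le_abs_self _)
  · have hw : w k = false := by simpa [hv] using hk
    rw [← moranLength_congr hvw, abs_sub_comm]
    exact (h.le_moranPoint_sub (fun i hi => (hvw i hi).symm) hw hv).trans (le_abs_self _)

lemma eq_of_abs_moranPoint_sub_lt (h : HasRatioBounds A B a b) {v w : ℕ → Bool} {n : ℕ} {R : ℝ}
    (hd : |moranPoint a b w - moranPoint a b v| < R)
    (hR : ∀ k < n, R ≤ (1 - B) * moranLength a b v k) : ∀ i < n, w i = v i := by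
  intro i
  induction i using Nat.strong_induction_on with
  | _ i ih =>
    intro hi
    by_contra hne
    exact (hd.trans_le (hR i hi)).not_ge
      (h.le_abs_moranPoint_sub (fun j hj => ih j hj (hj.trans hi)) hne)

lemma moranInterval_subset_ball (h : HasRatioBounds A B a b) {v : ℕ → Bool} {n : ℕ} {r : ℝ}
    (hr : moranLength a b v n < r) :
    moranInterval a b v n ⊆ Metric.ball (moranPoint a b v) r := by
  intro x hx
  have hdist := Real.dist_le_of_mem_Icc hx (moranPoint_mem h.a_pos h.b_pos h.add_lt_one v n)
  rw [add_sub_cancel_left] at hdist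
  exact hdist.trans_lt hr

lemma continuous_moranPoint (h : HasRatioBounds A B a b) : Continuous (moranPoint a b) := by
  refine continuous_iff_continuousAt.2 fun v => Metric.tendsto_nhds.2 fun ε hε => ?_
  obtain ⟨n, hn⟩ := h.exists_length_lt v hε
  filter_upwards [(PiNat.isOpen_cylinder _ v n).mem_nhds (PiNat.self_mem_cylinder v n)] with w hw
  exact h.moranInterval_subset_ball hn
    ((moranPoint_mem_iff h.a_pos h.b_pos h.add_lt_one v w n).2 (PiNat.mem_cylinder_iff.1 hw))

lemma isClosed_range_moranPoint (h : HasRatioBounds A B a b) :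
    IsClosed (range (moranPoint a b)) :=
  (isCompact_range h.continuous_moranPoint).isClosed

end Point

section Measure

lemma moranMeasure_moranInterval_eq_ofReal (h : HasRatioBounds A B a b) (p : ℕ → unitInterval)
    (v : ℕ → Bool) (n : ℕ) :
    moranMeasure a b p (moranInterval a b v n) = ENNReal.ofReal (branchMass p v n) := by
  induction n with
  | zero => simp [moranMeasure_moranInterval h.a_pos h.b_pos h.add_lt_one, branchMass]
  | succ n ih =>
    have hweight : 0 ≤ branchWeight (p n) (v n) := by
      cases v n
      exacts [(p n).2.1, sub_nonneg.2 (p n).2.2]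
    rw [branchMass_succ, mul_comm, ENNReal.ofReal_mul hweight, ← ih]
    cases hv : v n
    · exact moranMeasure_left h.a_pos h.b_pos h.add_lt_one p v n hv
    · exact moranMeasure_right h.a_pos h.b_pos h.add_lt_one p v n hv

lemma support_subset_range (h : HasRatioBounds A B a b) (p : ℕ → unitInterval) :
    (moranMeasure a b p).support ⊆ range (moranPoint a b) := by
  refine Measure.support_subset_of_isClosed h.isClosed_range_moranPoint ?_
  exact (ae_map_iff (measurable_moranPoint a b).aemeasurable
    h.isClosed_range_moranPoint.measurableSet).2 (ae_of_all _ mem_range_self)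

lemma measure_ball_le (h : HasRatioBounds A B a b) (p : ℕ → unitInterval) {v : ℕ → Bool} {n : ℕ}
    {R : ℝ} (hR : ∀ k < n, R ≤ (1 - B) * moranLength a b v k) :
    moranMeasure a b p (Metric.ball (moranPoint a b v) R) ≤ ENNReal.ofReal (branchMass p v n) := by
  rw [← h.moranMeasure_moranInterval_eq_ofReal, moranMeasure,
    Measure.map_apply (measurable_moranPoint a b) Metric.isOpen_ball.measurableSet,
    Measure.map_apply (measurable_moranPoint a b)
      (by exact measurableSet_Icc : MeasurableSet (moranInterval a b v n))]
  exact measure_mono fun w hw => (moranPoint_mem_iff h.a_pos h.b_pos h.add_lt_one v w n).2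
    (h.eq_of_abs_moranPoint_sub_lt hw hR)

lemma le_measure_ball (h : HasRatioBounds A B a b) (p : ℕ → unitInterval) {v : ℕ → Bool} {n : ℕ}
    {r : ℝ} (hr : moranLength a b v n < r) :
    ENNReal.ofReal (branchMass p v n) ≤ moranMeasure a b p (Metric.ball (moranPoint a b v) r) :=
  (h.moranMeasure_moranInterval_eq_ofReal p v n).symm.trans_le
    (measure_mono (h.moranInterval_subset_ball hr))

lemma moranPoint_mem_support (h : HasRatioBounds A B a b) {p : ℕ → unitInterval}
    (hp : ∀ n, (p n : ℝ) ∈ Ioo (0 : ℝ) 1) (v : ℕ → Bool) :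
    moranPoint a b v ∈ (moranMeasure a b p).support := by
  refine Metric.nhds_basis_ball.mem_measureSupport.2 fun r hr => ?_
  obtain ⟨n, hn⟩ := h.exists_length_lt v hr
  exact (ENNReal.ofReal_pos.2 (branchMass_pos hp v n)).trans_le (h.le_measure_ball p hn)

lemma exists_window (h : HasRatioBounds A B a b) {p : ℕ → unitInterval}
    (hp : ∀ n, (p n : ℝ) ∈ Ioo (0 : ℝ) 1) (v : ℕ → Bool) {r R : ℝ} (hr : 0 < r) (hrR : r ≤ R)
    (hR : R ≤ 1 - B) :
    ∃ N n, moranMeasure a b p (Metric.ball (moranPoint a b v) R) /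
          moranMeasure a b p (Metric.ball (moranPoint a b v) r) ≤
        ENNReal.ofReal (branchMass p v N / branchMass p v (N + n)) ∧
      moranLength a b v N / moranLength a b v (N + n) ≤ 1 / ((1 - B) * A) * (R / r) ∧
      A * R ≤ moranLength a b v N ∧ moranLength a b v (N + n) < r := by
  have hA := h.A_pos
  have hB : 0 < 1 - B := sub_pos.2 h.B_lt_one
  have hR₀ : 0 < R := hr.trans_le hrR
  have hRB : R ≤ R / (1 - B) := le_div_self hR₀.le hB (sub_le_self 1 h.B_pos.le)
  have hRB₁ : R / (1 - B) ≤ 1 := (div_le_one₀ hB).2 hR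
  obtain ⟨N, hN_lt, hN_ge, hN⟩ := h.exists_first_length_lt v (hR₀.trans_le hRB) hRB₁
  obtain ⟨M, hM_lt, hM_ge, -⟩ := h.exists_first_length_lt v hr (hrR.trans (hRB.trans hRB₁))
  obtain ⟨n, rfl⟩ : ∃ n, M = N + n := Nat.exists_eq_add_of_le <| not_lt.1 fun hMN =>
    (hM_lt.trans_le (hrR.trans hRB)).not_ge (hN M hMN)
  refine ⟨N, n, ?_, ?_, (mul_le_mul_of_nonneg_left hRB hA.le).trans hN_ge, hM_lt⟩
  · rw [ENNReal.ofReal_div_of_pos (branchMass_pos hp v _)]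
    exact ENNReal.div_le_div (h.measure_ball_le p fun k hk => (div_le_iff₀' hB).1 (hN k hk))
      (h.le_measure_ball p hM_lt)
  · calc moranLength a b v N / moranLength a b v (N + n) ≤ R / (1 - B) / (A * r) := by gcongr
      _ = 1 / ((1 - B) * A) * (R / r) := by field_simp

end Measure

section Exponents

lemma mul_log_length_sub_log_branchMass (h : HasRatioBounds A B a b) {p : ℕ → unitInterval}
    (hp : ∀ n, (p n : ℝ) ∈ Ioo (0 : ℝ) 1) (θ : ℝ) (v : ℕ → Bool) (N n : ℕ) :
    θ * Real.log (moranLength a b v (N + n)) - Real.log (branchMass p v (N + n)) =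
      θ * Real.log (moranLength a b v N) - Real.log (branchMass p v N) +
        ∑ i ∈ Finset.range n,
          branchExcess θ (a (N + i)) (b (N + i)) (p (N + i)) (v (N + i)) := by
  induction n with
  | zero => simp
  | succ n ih =>
    rw [Finset.sum_range_succ, ← add_assoc _ _ (branchExcess _ _ _ _ _), ← ih, ← add_assoc,
      moranLength_succ, branchMass_succ,
      Real.log_mul (h.branchRatio_pos _ _).ne' (h.length_pos v _).ne',
      Real.log_mul (branchMass_pos hp v _).ne' (branchWeight_pos (hp _) _).ne', branchExcess]
    ring

lemma branchMass_div_le_rpow (h : HasRatioBounds A B a b) {p : ℕ → unitInterval}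
    (hp : ∀ n, (p n : ℝ) ∈ Ioo (0 : ℝ) 1) (v : ℕ → Bool) {d : ℝ} {N n : ℕ}
    (hsum : ∑ i ∈ Finset.range n, excess d (a (N + i)) (b (N + i)) (p (N + i)) ≤ 0) :
    branchMass p v N / branchMass p v (N + n) ≤
      (moranLength a b v N / moranLength a b v (N + n)) ^ d := by
  have hM := branchMass_pos hp v
  have hL := h.length_pos v
  have hbranch : ∑ i ∈ Finset.range n,
      branchExcess d (a (N + i)) (b (N + i)) (p (N + i)) (v (N + i)) ≤ 0 :=
    (Finset.sum_le_sum fun i _ => branchExcess_le_excess _).trans hsum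
  have hpot := h.mul_log_length_sub_log_branchMass hp d v N n
  rw [← Real.log_le_log_iff (div_pos (hM _) (hM _))
      (Real.rpow_pos_of_pos (div_pos (hL _) (hL _)) _), Real.log_rpow (div_pos (hL _) (hL _)),
    Real.log_div (hM _).ne' (hM _).ne', Real.log_div (hL _).ne' (hL _).ne']
  linarith

lemma exists_branch_sum_excess_eq (h : HasRatioBounds A B a b) {p : ℕ → unitInterval}
    (hp : ∀ n, (p n : ℝ) ∈ Ioo (0 : ℝ) 1) (θ : ℝ) :
    ∃ v, ∀ n, ∑ i ∈ Finset.range n, excess θ (a i) (b i) (p i) =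
      θ * Real.log (moranLength a b v n) - Real.log (branchMass p v n) := by
  choose v hv using fun i => exists_branchExcess_eq_excess θ (a i) (b i) (p i)
  refine ⟨v, fun n => ?_⟩
  simpa [moranLength, branchMass, hv] using
    (h.mul_log_length_sub_log_branchMass hp θ v 0 n).symm

theorem mem_upperExponents (h : HasRatioBounds A B a b) {p : ℕ → unitInterval}
    (hp : ∀ n, (p n : ℝ) ∈ Ioo (0 : ℝ) 1) {d : ℝ} (hd : 0 ≤ d)
    (hsum : LongWindowSumsNonpos fun i => excess d (a i) (b i) (p i))
    {Φ : ℝ → ℝ} (hΦ : IsLarge Φ) : d ∈ upperExponents Φ (moranMeasure a b p) := by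
  have hA := h.A_pos
  have hB : 0 < 1 - B := sub_pos.2 h.B_lt_one
  obtain ⟨c, hc, hev⟩ := hsum
  obtain ⟨n₀, hn₀⟩ := eventually_atTop.1 hev
  obtain ⟨u, hu, hwindow⟩ := mem_nhdsGT_iff_exists_Ioc_subset.1 <|
    hΦ.eventually_le_and_le_exp hA (h.A_lt_B.trans h.B_lt_one) h.B_pos h.B_lt_one hc n₀
  refine ⟨min u (1 - B), (1 / ((1 - B) * A)) ^ d, lt_min hu hB,
    (min_le_right _ _).trans_lt (sub_lt_self 1 h.B_pos), by positivity, ?_⟩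
  intro r R hr hrR hRR hR hRC x hx
  obtain ⟨v, rfl⟩ := h.support_subset_range p hx
  obtain ⟨N, n, hmass, hlength, hN, hn⟩ :=
    h.exists_window hp v hr (hrR.le.trans hRR) (hRC.trans (min_le_right _ _))
  have hpow : A ^ (n + 1) ≤ R ^ Φ R := by
    refine le_of_mul_le_mul_left ?_ hR
    calc R * A ^ (n + 1) = A ^ n * (A * R) := by ring
      _ ≤ A ^ n * moranLength a b v N := by gcongr
      _ ≤ moranLength a b v (N + n) := h.pow_mul_length_le v N n
      _ ≤ R ^ (1 + Φ R) := (hn.trans hrR).le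
      _ = R * R ^ Φ R := by rw [Real.rpow_add hR, Real.rpow_one]
  obtain ⟨hn₀n, hNn⟩ := hwindow ⟨hR, hRC.trans (min_le_left _ _)⟩ N n
    (hN.trans (h.length_le_pow v N)) hpow
  refine hmass.trans (ENNReal.ofReal_le_ofReal ?_)
  calc branchMass p v N / branchMass p v (N + n)
      ≤ (moranLength a b v N / moranLength a b v (N + n)) ^ d :=
        h.branchMass_div_le_rpow hp v (hn₀ n hn₀n N hNn)
    _ ≤ (1 / ((1 - B) * A) * (R / r)) ^ d :=
        Real.rpow_le_rpow (div_pos (h.length_pos v _) (h.length_pos v _)).le hlength hd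
    _ = (1 / ((1 - B) * A)) ^ d * (R / r) ^ d := Real.mul_rpow (by positivity) (by positivity)

lemma exists_eventually_sum_excess_le (h : HasRatioBounds A B a b) {p : ℕ → unitInterval}
    (hp : ∀ n, (p n : ℝ) ∈ Ioo (0 : ℝ) 1) {Φ : ℝ → ℝ} (hΦ : ∃ᶠ R in 𝓝[>] (0 : ℝ), 0 ≤ Φ R)
    {d θ : ℝ} (hd : d ∈ upperExponents Φ (moranMeasure a b p)) (hdθ : d ≤ θ) :
    ∃ K : ℝ, ∀ᶠ n : ℕ in atTop,
      ∑ i ∈ Finset.range n, excess θ (a i) (b i) (p i) ≤ n * ((θ - d) * Real.log B) + K := by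
  have hB : 0 < 1 - B := sub_pos.2 h.B_lt_one
  obtain ⟨v, hv⟩ := h.exists_branch_sum_excess_eq hp θ
  have hL := h.length_pos v
  obtain ⟨C, hC, hball⟩ :=
    exists_mul_rpow_le_measureReal_ball (h.moranPoint_mem_support hp v) hΦ hd
  have hradius : Tendsto (fun n => (1 - B) * moranLength a b v n) atTop (𝓝[>] 0) :=
    tendsto_nhdsWithin_iff.2 ⟨by simpa using (h.tendsto_length v).const_mul (1 - B),
      .of_forall fun n => mul_pos hB (hL n)⟩
  refine ⟨-(Real.log C + d * Real.log (1 - B)), ?_⟩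
  filter_upwards [hradius.eventually hball] with n hn
  have hmass : C * ((1 - B) * moranLength a b v n) ^ d ≤ branchMass p v n :=
    hn.trans <| ENNReal.toReal_le_of_le_ofReal (branchMass_pos hp v n).le <|
      h.measure_ball_le p fun k hk => mul_le_mul_of_nonneg_left (h.length_antitone v hk.le) hB.le
  have hpos := mul_pos hB (hL n)
  have hlog := Real.log_le_log (mul_pos hC (Real.rpow_pos_of_pos hpos d)) hmass
  rw [Real.log_mul hC.ne' (Real.rpow_pos_of_pos hpos d).ne', Real.log_rpow hpos,
    Real.log_mul hB.ne' (hL n).ne'] at hlog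
  have hlength : Real.log (moranLength a b v n) ≤ n * Real.log B :=
    (Real.log_le_log (hL n) (h.length_le_pow v n)).trans_eq (Real.log_pow _ _)
  calc ∑ i ∈ Finset.range n, excess θ (a i) (b i) (p i)
      = θ * Real.log (moranLength a b v n) - Real.log (branchMass p v n) := hv n
    _ ≤ (θ - d) * Real.log (moranLength a b v n) - (Real.log C + d * Real.log (1 - B)) := by
      linarith
    _ ≤ (θ - d) * (n * Real.log B) - (Real.log C + d * Real.log (1 - B)) := by
      gcongr
    _ = n * ((θ - d) * Real.log B) + -(Real.log C + d * Real.log (1 - B)) := by ring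

theorem le_of_mem_upperExponents (h : HasRatioBounds A B a b) {p : ℕ → unitInterval}
    (hp : ∀ n, (p n : ℝ) ∈ Ioo (0 : ℝ) 1) {α : ℝ}
    (hmean : Tendsto (fun n : ℕ => (∑ i ∈ Finset.range n, excess α (a i) (b i) (p i)) / n)
      atTop (𝓝 0))
    {Φ : ℝ → ℝ} (hΦ : ∃ᶠ R in 𝓝[>] (0 : ℝ), 0 ≤ Φ R) {d : ℝ}
    (hd : d ∈ upperExponents Φ (moranMeasure a b p)) : α ≤ d := by
  by_contra! hlt
  obtain ⟨K, hK⟩ := h.exists_eventually_sum_excess_le hp hΦ hd hlt.le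
  have hlim : Tendsto (fun n : ℕ => (α - d) * Real.log B + K / n) atTop
      (𝓝 ((α - d) * Real.log B)) := by
    simpa using (tendsto_const_div_atTop_nhds_zero_nat K).const_add ((α - d) * Real.log B)
  have hle : ∀ᶠ n : ℕ in atTop, (∑ i ∈ Finset.range n, excess α (a i) (b i) (p i)) / n ≤
      (α - d) * Real.log B + K / n := by
    filter_upwards [hK, eventually_gt_atTop 0] with n hn hn0
    have hn0' : (0 : ℝ) < n := Nat.cast_pos.2 hn0
    rw [div_le_iff₀ hn0', add_mul, div_mul_cancel₀ _ hn0'.ne']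
    linarith
  exact (le_of_tendsto_of_tendsto hmean hlim hle).not_gt
    (mul_neg_of_pos_of_neg (sub_pos.2 hlt) (Real.log_neg h.B_pos h.B_lt_one))

end Exponents

end HasRatioBounds

section Independence

variable {Ω ι E F : Type*} [MeasurableSpace Ω] [MeasurableSpace E] [MeasurableSpace F]
  {P : Measure Ω} {X : ι → Ω → E} {Y : ι → Ω → F}

lemma measure_biInter_preimage_prod (hX : iIndepFun X P) (hY : iIndepFun Y P)
    (hXY : IndepFun (fun ω i => X i ω) (fun ω i => Y i ω) P) {S : Finset ι} {s : ι → Set E}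
    {t : ι → Set F} (hs : ∀ i ∈ S, MeasurableSet (s i)) (ht : ∀ i ∈ S, MeasurableSet (t i)) :
    P (⋂ i ∈ S, (fun ω => (X i ω, Y i ω)) ⁻¹' s i ×ˢ t i) =
      (∏ i ∈ S, P (X i ⁻¹' s i)) * ∏ i ∈ S, P (Y i ⁻¹' t i) := by
  have hinter : ⋂ i ∈ S, (fun ω => (X i ω, Y i ω)) ⁻¹' s i ×ˢ t i =
      (fun ω i => X i ω) ⁻¹' (S : Set ι).pi s ∩ (fun ω i => Y i ω) ⁻¹' (S : Set ι).pi t := by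
    ext ω
    simp [Set.mem_pi, forall_and]
  have hXpre : (fun ω i => X i ω) ⁻¹' (S : Set ι).pi s = ⋂ i ∈ S, X i ⁻¹' s i := by
    ext ω
    simp [Set.mem_pi]
  have hYpre : (fun ω i => Y i ω) ⁻¹' (S : Set ι).pi t = ⋂ i ∈ S, Y i ⁻¹' t i := by
    ext ω
    simp [Set.mem_pi]
  rw [hinter, hXY.measure_inter_preimage_eq_mul _ _ (.pi S.countable_toSet hs)
    (.pi S.countable_toSet ht), hXpre, hYpre, hX.measure_inter_preimage_eq_mul S hs,
    hY.measure_inter_preimage_eq_mul S ht]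

lemma iIndepFun_prodMk (mX : ∀ i, Measurable (X i)) (mY : ∀ i, Measurable (Y i))
    (hX : iIndepFun X P) (hY : iIndepFun Y P)
    (hXY : IndepFun (fun ω i => X i ω) (fun ω i => Y i ω) P) :
    iIndepFun (fun i ω => (X i ω, Y i ω)) P := by
  let rectangles : Set (Set (E × F)) := image2 (· ×ˢ ·) {s | MeasurableSet s} {t | MeasurableSet t}
  refine iIndepSets.iIndep (fun i => ((mX i).prodMk (mY i)).comap_le)
    (fun i => {s | ∃ u ∈ rectangles, (fun ω => (X i ω, Y i ω)) ⁻¹' u = s})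
    (fun i => isPiSystem_prod.comap _)
    (fun i => by rw [← generateFrom_prod, MeasurableSpace.comap_generateFrom]; rfl)
    ((iIndepSets_iff _ _).2 fun S f hf => ?_)
  have hrect : ∀ i ∈ S, ∃ s t, MeasurableSet s ∧ MeasurableSet t ∧
      (fun ω => (X i ω, Y i ω)) ⁻¹' s ×ˢ t = f i := fun i hi => by
    obtain ⟨_, ⟨s, hs, t, ht, rfl⟩, hst⟩ := hf i hi
    exact ⟨s, t, hs, ht, hst⟩
  choose! s t hs ht hst using hrect
  rw [← iInter₂_congr hst, measure_biInter_preimage_prod hX hY hXY hs ht,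
    ← Finset.prod_mul_distrib]
  refine Finset.prod_congr rfl fun i hi => ?_
  have hpair : IndepFun (X i) (Y i) P := hXY.comp (measurable_pi_apply i) (measurable_pi_apply i)
  rw [← hpair.measure_inter_preimage_eq_mul _ _ (hs i hi) (ht i hi), ← hst i hi, mk_preimage_prod]

end Independence

section Moments

variable {Ω : Type*} [MeasurableSpace Ω] {P : Measure Ω}

lemma ae_pos_of_lintegral_rpow_neg_lt_top {q : Ω → ℝ} (hq : Measurable q) {t : ℝ} (ht : 0 < t)
    (hfin : ∫⁻ ω, ENNReal.ofReal (q ω) ^ (-t) ∂P < ⊤) : ∀ᵐ ω ∂P, 0 < q ω := by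
  filter_upwards [ae_lt_top (hq.ennreal_ofReal.pow_const (-t)) hfin.ne] with ω hω
  by_contra! hle
  simp [ENNReal.ofReal_of_nonpos hle, ENNReal.zero_rpow_of_neg (neg_lt_zero.2 ht)] at hω

lemma integrable_rpow_neg_of_lintegral_lt_top {q : Ω → ℝ} (hq : Measurable q) {t : ℝ} (ht : 0 < t)
    (hfin : ∫⁻ ω, ENNReal.ofReal (q ω) ^ (-t) ∂P < ⊤) : Integrable (fun ω => q ω ^ (-t)) P := by
  have hpos := ae_pos_of_lintegral_rpow_neg_lt_top hq ht hfin
  refine (lintegral_ofReal_ne_top_iff_integrable (hq.pow_const _).aestronglyMeasurable ?_).1 ?_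
  · filter_upwards [hpos] with ω hω using Real.rpow_nonneg hω.le _
  · refine ((lintegral_congr_ae ?_).trans_lt hfin).ne
    filter_upwards [hpos] with ω hω using (ENNReal.ofReal_rpow_of_pos hω).symm

lemma zero_mem_interior_integrableExpSet [IsFiniteMeasure P] {X : Ω → ℝ} (hX : AEMeasurable X P)
    {m t : ℝ} (hm : ∀ᵐ ω ∂P, m ≤ X ω) (ht : 0 < t) (hint : t ∈ integrableExpSet X P) :
    0 ∈ interior (integrableExpSet X P) := by
  have hneg : (-1 : ℝ) ∈ integrableExpSet X P := by
    refine Integrable.of_bound (hX.const_mul _).exp.aestronglyMeasurable (Real.exp (-m)) ?_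
    filter_upwards [hm] with ω hω
    rw [Real.norm_of_nonneg (Real.exp_pos _).le, neg_one_mul]
    exact Real.exp_le_exp.2 (neg_le_neg hω)
  refine interior_mono (convex_integrableExpSet.ordConnected.out hneg hint) ?_
  rw [interior_Icc]
  exact ⟨neg_one_lt_zero, ht⟩

end Moments

section LargeDeviations

variable {Ω : Type*} [MeasurableSpace Ω] {P : Measure Ω}

lemma exists_mgf_lt_one [IsProbabilityMeasure P] {X : Ω → ℝ}
    (hint : 0 ∈ interior (integrableExpSet X P)) (hneg : ∫ ω, X ω ∂P < 0) :
    ∃ s, 0 < s ∧ s ∈ integrableExpSet X P ∧ mgf X P s < 1 := by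
  have hder : HasDerivAt (mgf X P) (∫ ω, X ω ∂P) 0 := by simpa using hasDerivAt_mgf hint
  have hslope : ∀ᶠ s in 𝓝[>] (0 : ℝ), slope (mgf X P) 0 s < 0 :=
    ((hasDerivAt_iff_tendsto_slope.1 hder).mono_left
      (nhdsWithin_mono 0 fun s (hs : 0 < s) => hs.ne')).eventually_lt_const hneg
  have hmem : ∀ᶠ s in 𝓝[>] (0 : ℝ), s ∈ integrableExpSet X P :=
    nhdsWithin_le_nhds (mem_interior_iff_mem_nhds.1 hint)
  obtain ⟨s, hs, hsint, hspos : 0 < s⟩ :=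
    (hslope.and (hmem.and self_mem_nhdsWithin)).exists
  refine ⟨s, hspos, hsint, ?_⟩
  rw [slope_def_field, sub_zero, mgf_zero, div_lt_iff₀ hspos, zero_mul] at hs
  exact sub_neg.1 hs

variable {X : ℕ → Ω → ℝ}

lemma measure_nonneg_sum_window_le (hmeas : ∀ i, Measurable (X i)) (hindep : iIndepFun X P)
    (hident : ∀ i, IdentDistrib (X i) (X 0) P P) {s : ℝ} (hs : 0 ≤ s)
    (hint : s ∈ integrableExpSet (X 0) P) (N n : ℕ) :
    P {ω | 0 ≤ ∑ i ∈ Finset.range n, X (N + i) ω} ≤ ENNReal.ofReal (mgf (X 0) P s ^ n) := by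
  have := hindep.isProbabilityMeasure
  have hind : iIndepFun (fun i => X (N + i)) P := hindep.precomp (add_right_injective N)
  have hexp : ∀ i, Integrable (fun ω => Real.exp (s * X i ω)) P := fun i =>
    ((hident i).comp (measurable_const_mul s).exp).integrable_iff.2 hint
  have hchernoff := measure_ge_le_exp_mul_mgf (X := ∑ i ∈ Finset.range n, X (N + i)) 0 hs
    (hind.integrable_exp_mul_sum (fun i => hmeas (N + i)) fun i _ => hexp (N + i))
  rw [hind.mgf_sum (fun i => hmeas (N + i)),
    Finset.prod_eq_pow_card fun i _ => mgf_congr_of_identDistrib _ _ (hident (N + i)) s,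
    Finset.card_range, mul_zero, Real.exp_zero, one_mul] at hchernoff
  simp only [Finset.sum_apply] at hchernoff
  rw [← ofReal_measureReal]
  exact ENNReal.ofReal_le_ofReal hchernoff

lemma measure_exists_nonneg_sum_window_le (hmeas : ∀ i, Measurable (X i))
    (hindep : iIndepFun X P) (hident : ∀ i, IdentDistrib (X i) (X 0) P P) {s c : ℝ} (hs : 0 ≤ s)
    (hint : s ∈ integrableExpSet (X 0) P) (hc : 0 ≤ c)
    (hmgf : mgf (X 0) P s ≤ Real.exp (-(2 * c))) (n : ℕ) :
    P {ω | ∃ N : ℕ, (N : ℝ) ≤ Real.exp (c * n) ∧ 0 ≤ ∑ i ∈ Finset.range n, X (N + i) ω} ≤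
      ENNReal.ofReal (2 * Real.exp (n * -c)) := by
  have hunion : {ω | ∃ N : ℕ, (N : ℝ) ≤ Real.exp (c * n) ∧
      0 ≤ ∑ i ∈ Finset.range n, X (N + i) ω} ⊆
        ⋃ N ∈ Finset.range (⌊Real.exp (c * n)⌋₊ + 1),
          {ω | 0 ≤ ∑ i ∈ Finset.range n, X (N + i) ω} := by
    rintro ω ⟨N, hN, hsum⟩
    exact mem_biUnion (Finset.mem_range.2 (Nat.lt_succ_of_le (Nat.le_floor hN))) hsum
  have hcard : ((⌊Real.exp (c * n)⌋₊ + 1 : ℕ) : ℝ) ≤ 2 * Real.exp (c * n) := by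
    push_cast
    linarith [Nat.floor_le (Real.exp_pos (c * n)).le, Real.one_le_exp (mul_nonneg hc n.cast_nonneg)]
  have hterm (N : ℕ) : P {ω | 0 ≤ ∑ i ∈ Finset.range n, X (N + i) ω} ≤
      ENNReal.ofReal (Real.exp (-(2 * c)) ^ n) :=
    (measure_nonneg_sum_window_le hmeas hindep hident hs hint N n).trans
      (ENNReal.ofReal_le_ofReal (pow_le_pow_left₀ mgf_nonneg hmgf n))
  refine ((measure_mono hunion).trans (measure_biUnion_finset_le _ _)).trans
    ((Finset.sum_le_card_nsmul _ _ _ fun N _ => hterm N).trans ?_)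
  rw [Finset.card_range, nsmul_eq_mul, ← ENNReal.ofReal_natCast,
    ← ENNReal.ofReal_mul (Nat.cast_nonneg _)]
  refine ENNReal.ofReal_le_ofReal ?_
  calc ((⌊Real.exp (c * n)⌋₊ + 1 : ℕ) : ℝ) * Real.exp (-(2 * c)) ^ n
      ≤ 2 * Real.exp (c * n) * Real.exp (-(2 * c)) ^ n := by gcongr
    _ = 2 * Real.exp (n * -c) := by
      rw [← Real.exp_nat_mul, mul_assoc, ← Real.exp_add]
      ring_nf

theorem ae_longWindowSumsNonpos (hmeas : ∀ i, Measurable (X i)) (hindep : iIndepFun X P)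
    (hident : ∀ i, IdentDistrib (X i) (X 0) P P)
    (hint : 0 ∈ interior (integrableExpSet (X 0) P)) (hneg : ∫ ω, X 0 ω ∂P < 0) :
    ∀ᵐ ω ∂P, LongWindowSumsNonpos fun i => X i ω := by
  have := hindep.isProbabilityMeasure
  obtain ⟨s, hs, hsint, hs1⟩ := exists_mgf_lt_one hint hneg
  have hmgf : 0 < mgf (X 0) P s := mgf_pos hsint
  obtain ⟨c, hc, hmgfc⟩ : ∃ c : ℝ, 0 < c ∧ mgf (X 0) P s ≤ Real.exp (-(2 * c)) := by
    refine ⟨-Real.log (mgf (X 0) P s) / 2, half_pos (neg_pos.2 (Real.log_neg hmgf hs1)), ?_⟩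
    rw [mul_div_cancel₀ _ two_ne_zero, neg_neg, Real.exp_log hmgf]
  have hsum : Summable fun n : ℕ => 2 * Real.exp (n * -c) :=
    (Real.summable_exp_nat_mul_iff.2 (neg_lt_zero.2 hc)).mul_left 2
  have hfin : ∑' n : ℕ, P {ω | ∃ N : ℕ, (N : ℝ) ≤ Real.exp (c * n) ∧
      0 ≤ ∑ i ∈ Finset.range n, X (N + i) ω} ≠ ⊤ :=
    ne_top_of_le_ne_top hsum.tsum_ofReal_ne_top <| ENNReal.tsum_le_tsum <|
      measure_exists_nonneg_sum_window_le hmeas hindep hident hs.le hsint hc.le hmgfc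
  filter_upwards [ae_eventually_notMem hfin] with ω hω
  exact ⟨c, hc, hω.mono fun n hn N hN => (not_le.1 fun hle => hn ⟨N, hN, hle⟩).le⟩

end LargeDeviations

namespace IsRandomMoranModel

/-- The excess, for the exponent `θ`, of the random ratios and weights of step `n`. -/
def levelExcess {Ω : Type*} (a b : ℕ → Ω → ℝ) (p : ℕ → Ω → unitInterval) (θ : ℝ) (n : ℕ)
    (ω : Ω) : ℝ :=
  excess θ (a n ω) (b n ω) (p n ω)

variable {Ω : Type*} [MeasurableSpace Ω] {P : Measure Ω} {A B : ℝ} {a b : ℕ → Ω → ℝ}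
  {p : ℕ → Ω → unitInterval}

lemma hasRatioBounds (h : IsRandomMoranModel P A B a b p) (ω : Ω) :
    HasRatioBounds A B (fun n => a n ω) (fun n => b n ω) where
  A_pos := h.A_pos
  B_lt_one := h.B_lt_one
  le_a n := (h.le_min n ω).trans (min_le_left _ _)
  le_b n := (h.le_min n ω).trans (min_le_right _ _)
  add_le n := h.add_le n ω

lemma log_B_neg (h : IsRandomMoranModel P A B a b p) : Real.log B < 0 :=
  Real.log_neg (h.A_pos.trans h.A_lt_B) h.B_lt_one

lemma ae_mem_Ioo (h : IsRandomMoranModel P A B a b p) :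
    ∀ᵐ ω ∂P, ∀ n, (p n ω : ℝ) ∈ Ioo (0 : ℝ) 1 := by
  obtain ⟨t, ht, hmoment⟩ := h.moment_p
  refine ae_all_iff.2 fun n => ?_
  have hp : Measurable fun ω => (p n ω : ℝ) := (h.measurable_p n).subtype_val
  filter_upwards [ae_pos_of_lintegral_rpow_neg_lt_top hp ht (hmoment n).1,
    ae_pos_of_lintegral_rpow_neg_lt_top (measurable_const.sub hp) ht (hmoment n).2]
    with ω hleft hright using ⟨hleft, sub_pos.1 hright⟩

section LevelExcess

lemma measurable_levelExcess (h : IsRandomMoranModel P A B a b p) (θ : ℝ) (n : ℕ) :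
    Measurable (levelExcess a b p θ n) :=
  (measurable_excess θ).comp
    (((h.measurable_a n).prodMk (h.measurable_b n)).prodMk (h.measurable_p n))

lemma iIndepFun_levelExcess (h : IsRandomMoranModel P A B a b p) (θ : ℝ) :
    iIndepFun (levelExcess a b p θ) P :=
  (iIndepFun_prodMk (fun i => (h.measurable_a i).prodMk (h.measurable_b i)) h.measurable_p
    h.indep_ab h.indep_p h.indep_ab_p).comp _ fun _ => measurable_excess θ

lemma identDistrib_levelExcess [IsFiniteMeasure P] (h : IsRandomMoranModel P A B a b p) (θ : ℝ)
    (n : ℕ) : IdentDistrib (levelExcess a b p θ n) (levelExcess a b p θ 0) P P := by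
  have hindep (n : ℕ) : IndepFun (fun ω => (a n ω, b n ω)) (p n) P :=
    h.indep_ab_p.comp (measurable_pi_apply n) (measurable_pi_apply n)
  exact ((h.ident_ab n).prodMk (h.ident_p n) (hindep n) (hindep 0)).comp (measurable_excess θ)

lemma abs_log_branchRatio_le (h : IsRandomMoranModel P A B a b p) (n : ℕ) (ω : Ω) (c : Bool) :
    |Real.log (branchRatio (a n ω) (b n ω) c)| ≤ -Real.log A := by
  have hmem := (h.hasRatioBounds ω).log_branchRatio_mem_Icc n c
  rw [abs_of_nonpos (hmem.2.trans h.log_B_neg.le)]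
  exact neg_le_neg hmem.1

lemma exists_pos_mem_integrableExpSet_levelExcess (h : IsRandomMoranModel P A B a b p) (θ : ℝ) :
    ∃ t, 0 < t ∧ t ∈ integrableExpSet (levelExcess a b p θ 0) P := by
  obtain ⟨t, ht, hmoment⟩ := h.moment_p
  have hp : Measurable fun ω => (p 0 ω : ℝ) := (h.measurable_p 0).subtype_val
  have hdom := ((integrable_rpow_neg_of_lintegral_lt_top hp ht (hmoment 0).1).add
    (integrable_rpow_neg_of_lintegral_lt_top (measurable_const.sub hp) ht
      (hmoment 0).2)).const_mul (Real.exp (t * (|θ| * -Real.log A)))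
  refine ⟨t, ht, hdom.mono'
    ((h.measurable_levelExcess θ 0).const_mul t).exp.aestronglyMeasurable ?_⟩
  filter_upwards [h.ae_mem_Ioo] with ω hω
  rw [Real.norm_of_nonneg (Real.exp_pos _).le]
  exact exp_mul_excess_le ht.le (h.abs_log_branchRatio_le 0 ω false)
    (h.abs_log_branchRatio_le 0 ω true) (hω 0)

lemma zero_mem_interior_integrableExpSet_levelExcess [IsFiniteMeasure P]
    (h : IsRandomMoranModel P A B a b p) (θ : ℝ) :
    0 ∈ interior (integrableExpSet (levelExcess a b p θ 0) P) := by
  obtain ⟨t, ht, hint⟩ := h.exists_pos_mem_integrableExpSet_levelExcess θ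
  have hlower : ∀ᵐ ω ∂P, -(|θ| * -Real.log A) ≤ levelExcess a b p θ 0 ω := by
    filter_upwards [h.ae_mem_Ioo] with ω hω
    exact neg_mul_le_excess (h.abs_log_branchRatio_le 0 ω false) (hω 0)
  exact zero_mem_interior_integrableExpSet (h.measurable_levelExcess θ 0).aemeasurable hlower ht
    hint

lemma integrable_levelExcess [IsFiniteMeasure P] (h : IsRandomMoranModel P A B a b p) (θ : ℝ) :
    Integrable (levelExcess a b p θ 0) P :=
  integrable_of_mem_interior_integrableExpSet (h.zero_mem_interior_integrableExpSet_levelExcess θ)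

end LevelExcess

section Expectations

lemma Zval_mem_Icc (h : IsRandomMoranModel P A B a b p) (θ : ℝ) (ω : Ω) :
    Zval θ (a 0 ω) (b 0 ω) (p 0 ω) ∈ Icc (Real.log A) (Real.log B) := by
  have hlog := (h.hasRatioBounds ω).log_branchRatio_mem_Icc 0
  unfold Zval
  split_ifs
  exacts [hlog false, hlog true]

lemma integrable_Zval [IsFiniteMeasure P] (h : IsRandomMoranModel P A B a b p) (θ : ℝ) :
    Integrable (fun ω => Zval θ (a 0 ω) (b 0 ω) (p 0 ω)) P := by
  have ha := h.measurable_a 0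
  have hb := h.measurable_b 0
  have hcond : MeasurableSet {ω | (p 0 ω : ℝ) ≤ a 0 ω ^ θ / (a 0 ω ^ θ + b 0 ω ^ θ)} :=
    measurableSet_le (h.measurable_p 0).subtype_val
      ((ha.pow_const θ).div ((ha.pow_const θ).add (hb.pow_const θ)))
  exact .of_mem_Icc _ _ (Measurable.ite hcond ha.log hb.log).aemeasurable
    (ae_of_all _ (h.Zval_mem_Icc θ))

lemma G_nonneg (h : IsRandomMoranModel P A B a b p) (θ : ℝ) : 0 ≤ G P a b p θ :=
  div_nonneg_of_nonpos (integral_nonpos fun ω => Yval_nonpos (p 0 ω).2)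
    (integral_nonpos fun ω => (h.Zval_mem_Icc θ ω).2.trans h.log_B_neg.le)

variable [IsProbabilityMeasure P]

lemma integral_Zval_neg (h : IsRandomMoranModel P A B a b p) (θ : ℝ) :
    ∫ ω, Zval θ (a 0 ω) (b 0 ω) (p 0 ω) ∂P < 0 := by
  calc ∫ ω, Zval θ (a 0 ω) (b 0 ω) (p 0 ω) ∂P ≤ ∫ _, Real.log B ∂P :=
        integral_mono (h.integrable_Zval θ) (integrable_const _) fun ω => (h.Zval_mem_Icc θ ω).2
    _ = Real.log B := by simp
    _ < 0 := h.log_B_neg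

lemma integral_levelExcess (h : IsRandomMoranModel P A B a b p) (θ : ℝ) :
    ∫ ω, levelExcess a b p θ 0 ω ∂P =
      (θ - G P a b p θ) * ∫ ω, Zval θ (a 0 ω) (b 0 ω) (p 0 ω) ∂P := by
  have hZ := (h.integrable_Zval θ).const_mul θ
  have hX := h.integrable_levelExcess θ
  have hY : (fun ω => Yval θ (a 0 ω) (b 0 ω) (p 0 ω)) =ᵐ[P]
      fun ω => θ * Zval θ (a 0 ω) (b 0 ω) (p 0 ω) - levelExcess a b p θ 0 ω := by
    filter_upwards [h.ae_mem_Ioo] with ω hω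
    rw [levelExcess, excess_eq ((h.hasRatioBounds ω).a_pos 0) ((h.hasRatioBounds ω).b_pos 0) (hω 0),
      sub_sub_cancel]
  rw [sub_mul, G, div_mul_cancel₀ _ (h.integral_Zval_neg θ).ne, integral_congr_ae hY,
    integral_sub hZ hX, integral_const_mul, sub_sub_cancel]

lemma integral_levelExcess_neg (h : IsRandomMoranModel P A B a b p) {α ψ : ℝ}
    (hα : G P a b p α = α) (hψ : α < ψ) : ∫ ω, levelExcess a b p ψ 0 ω ∂P < 0 := by
  have hle (ω : Ω) :
      levelExcess a b p ψ 0 ω ≤ levelExcess a b p α 0 ω + (ψ - α) * Real.log B := by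
    have hlog := fun c => ((h.hasRatioBounds ω).log_branchRatio_mem_Icc 0 c).2
    have hbound : excess (α + (ψ - α)) (a 0 ω) (b 0 ω) (p 0 ω) ≤
        excess α (a 0 ω) (b 0 ω) (p 0 ω) + (ψ - α) * Real.log B :=
      excess_add_le (sub_nonneg.2 hψ.le) (hlog false) (hlog true)
    rwa [add_sub_cancel] at hbound
  have hint := h.integrable_levelExcess α
  calc ∫ ω, levelExcess a b p ψ 0 ω ∂P
      ≤ ∫ ω, (levelExcess a b p α 0 ω + (ψ - α) * Real.log B) ∂P :=
        integral_mono (h.integrable_levelExcess ψ) (hint.add (integrable_const _)) hle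
    _ = (ψ - α) * Real.log B := by
        rw [integral_add hint (integrable_const _), h.integral_levelExcess, hα]
        simp
    _ < 0 := mul_neg_of_pos_of_neg (sub_pos.2 hψ) h.log_B_neg

lemma ae_longWindowSumsNonpos_levelExcess (h : IsRandomMoranModel P A B a b p) {α ψ : ℝ}
    (hα : G P a b p α = α) (hψ : α < ψ) :
    ∀ᵐ ω ∂P, LongWindowSumsNonpos fun i => levelExcess a b p ψ i ω :=
  ae_longWindowSumsNonpos (h.measurable_levelExcess ψ) (h.iIndepFun_levelExcess ψ)
    (h.identDistrib_levelExcess ψ) (h.zero_mem_interior_integrableExpSet_levelExcess ψ)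
    (h.integral_levelExcess_neg hα hψ)

lemma ae_tendsto_mean_levelExcess (h : IsRandomMoranModel P A B a b p) {α : ℝ}
    (hα : G P a b p α = α) :
    ∀ᵐ ω ∂P, Tendsto (fun n : ℕ => (∑ i ∈ Finset.range n, levelExcess a b p α i ω) / n)
      atTop (𝓝 0) := by
  have hmean : ∫ ω, levelExcess a b p α 0 ω ∂P = 0 := by
    rw [h.integral_levelExcess, hα, sub_self, zero_mul]
  rw [← hmean]
  exact strong_law_ae_real (levelExcess a b p α) (h.integrable_levelExcess α)
    (fun _ _ hij => (h.iIndepFun_levelExcess α).indepFun hij) (h.identDistrib_levelExcess α)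

end Expectations

end IsRandomMoranModel

end RandomMoran

end

theorem mainTheorem5_general {Ω : Type*} [MeasurableSpace Ω] (P : Measure Ω)
    [IsProbabilityMeasure P] (A B : ℝ) (a b : ℕ → Ω → ℝ) (p : ℕ → Ω → unitInterval)
    (hmodel : RandomMoran.IsRandomMoranModel P A B a b p)
    (α : ℝ) (hGα : RandomMoran.G P a b p α = α) :
    ∀ᵐ ω ∂P, ∀ Φ : ℝ → ℝ, RandomMoran.IsLarge Φ →
      RandomMoran.upperPhiDim Φ (RandomMoran.randomMoranMeasure a b p ω) = (α : EReal) := by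
  have hα : 0 ≤ α := hGα ▸ hmodel.G_nonneg α
  obtain ⟨ψ, -, hαψ, hψ⟩ := exists_seq_strictAnti_tendsto α
  filter_upwards [hmodel.ae_mem_Ioo, hmodel.ae_tendsto_mean_levelExcess hGα,
    ae_all_iff.2 fun k => hmodel.ae_longWindowSumsNonpos_levelExcess hGα (hαψ k)]
    with ω hp hmean hsum Φ hΦ
  have hratio := hmodel.hasRatioBounds ω
  have hmem (k : ℕ) := hratio.mem_upperExponents hp (hα.trans (hαψ k).le) (hsum k) hΦ
  exact RandomMoran.upperPhiDim_eq_coe_of_isGLB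
    ⟨fun d hd => hratio.le_of_mem_upperExponents hp hmean hΦ.eventually_nonneg.frequently hd,
      fun c hc => ge_of_tendsto' hψ fun k => hc (hmem k)⟩

theorem mainTheorem5 {Ω : Type*} [MeasurableSpace Ω] (P : Measure Ω) [IsProbabilityMeasure P]
    (A B : ℝ) (a b : ℕ → Ω → ℝ) (p : ℕ → Ω → unitInterval)
    (hmodel : RandomMoran.IsRandomMoranModel P A B a b p)
    (α : ℝ) (hα : 0 ≤ α) (hGα : RandomMoran.G P a b p α = α)
    (hG : ∀ ψ : ℝ, α < ψ → RandomMoran.G P a b p ψ < ψ) :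
    ∃ Γ : Set Ω, MeasurableSet Γ ∧ P Γ = 1 ∧
      ∀ Φ : ℝ → ℝ, RandomMoran.IsDimensionFunction Φ → RandomMoran.IsLarge Φ →
        ∀ ω ∈ Γ,
          RandomMoran.upperPhiDim Φ (RandomMoran.randomMoranMeasure a b p ω) = (α : EReal) := by
  obtain ⟨Γ, hΓ, hmeas, h⟩ :=
    (mainTheorem5_general P A B a b p hmodel α hGα).exists_measurable_mem
  exact ⟨Γ, hmeas, (mem_ae_iff_prob_eq_one hmeas).1 hΓ, fun Φ _ hΦ ω hω => h ω hω Φ hΦ⟩
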